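/- Let $\mathbb{M}_n$ be the space of complex $n\times n$ matrices and $\mathbb{M}_n^+$ its positive semidefinite part. For $X\in\mathbb{M}_n$ put $|X|=(X^*X)^{1/2}$, and for $X\in\mathbb{M}_n^+$ let $\lambda_1(X)\ge\dots\ge\lambda_n(X)$ be the eigenvalues of $X$, counted with multiplicity. For $X,Y\in\mathbb{M}_n^+$ write $X\prec_{w\log}Y$ ($X$ is weakly log-majorized by $Y$) if $$\prod_{j=1}^k\lambda_j(X)\le\prod_{j=1}^k\lambda_j(Y)\qquad\text{for all } k=1,\dots,n.$$ Let $A\in\mathbb{M}_n^+$ and let $X_1,\dots,X_m\in\mathbb{M}_n$ be normal. Then, for all real $p\ge 1$, $$\left|A\left(\sum_{k=1}^m X_k\right)A\right|^p\prec_{w\log} m^{p-1}A^p\left(\sum_{k=1}^m|X_k|^p\right)A^p.$$ In particular (the case $m=2$), $|A(X+Y)A|^p\prec_{w\log}2^{p-1}A^p(|X|^p+|Y|^p)A^p$ for all normal $X,Y\in\mathbb{M}_n$. -/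

import Mathlib

-- Matrices carry the Loewner order (`A ≤ B` iff `B - A` is positive semidefinite) wherever the
-- continuous functional calculus (`CFC.abs X = |X| = (X* X)^(1/2)` and `A ^ p`, `p` real) needs it.
open scoped MatrixOrder ComplexOrder

/-- The product of the `k` largest eigenvalues, with multiplicities, of a Hermitian matrix:
`eigenvalues₀` lists them in decreasing order, indexed from `0`. -/
noncomputable def topEigenvalueProd {n : ℕ} {X : Matrix (Fin n) (Fin n) ℂ}
    (hX : X.IsHermitian) (k : ℕ) : ℝ :=
  ∏ j ∈ Finset.univ.filter (fun j : Fin (Fintype.card (Fin n)) => (j : ℕ) < k), hX.eigenvalues₀ j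

/-- Weak log-majorization `X ≺_{wlog} Y` of positive semidefinite matrices `X` and `Y`. -/
def WeakLogMajorized {n : ℕ} (X Y : Matrix (Fin n) (Fin n) ℂ) : Prop :=
  ∃ (hX : X.PosSemidef) (hY : Y.PosSemidef), ∀ k : ℕ, 1 ≤ k → k ≤ n →
    topEigenvalueProd hX.isHermitian k ≤ topEigenvalueProd hY.isHermitian k

/-! The product of the `k` largest eigenvalues of a positive semidefinite matrix is the operator
norm of its `k`-th compound matrix, so each inequality of the log-majorization becomes a norm
inequality for compounds (`norm_compound_eq_topEigenvalueProd`). Compounds respect products,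
adjoints and powers of positive semidefinite matrices.

Put `S = ∑ X_j` and `W = m^(p-1) ∑ |X_j|^p`. Normality makes each block matrix `[|X_j|, X_j; X_j*,
|X_j|]` positive semidefinite, and operator concavity of `x ↦ x^(1/p)` gives `∑ |X_j| ≤ W^(1/p)`.
Hence `[T, S; S*, T]` with `T = W^(1/p)` is positive semidefinite, and so is its conjugate by
`diag(A, A)`. Such a block bounds the compound norm of the corner `ASA` by that of `A W^(1/p) A`.
The Araki–Cordes inequality, applied to compounds, then passes to `A^p W A^p`. -/

namespace Matrix

open Finset Equiv

/-! ### Compound matrices and the Cauchy–Binet formula. -/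

/-- Summing over all tuples a function that is invariant under permutations of the entries and
vanishes on tuples with a repetition amounts to summing `k!` times over increasing tuples. -/
theorem sum_tuples_eq_factorial_smul_sum_orderEmb {ι : Type*} [Fintype ι] [LinearOrder ι]
    {R : Type*} [AddCommMonoid R] {k : ℕ} (F : (Fin k → ι) → R)
    (hperm : ∀ (f : Fin k → ι) (σ : Perm (Fin k)), F (f ∘ σ) = F f)
    (hinj : ∀ f : Fin k → ι, ¬ Function.Injective f → F f = 0) :
    ∑ f, F f = k.factorial • ∑ e : Fin k ↪o ι, F e := by
  classical
  have h1 : ∑ f, F f = ∑ f ∈ univ.filter (fun f : Fin k → ι => Function.Injective f), F f :=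
    (sum_filter_of_ne fun f _ hf => by_contra fun h => hf (hinj f h)).symm
  have h2 : ∑ x : (Fin k ↪o ι) × Perm (Fin k), F (x.1 ∘ x.2)
      = ∑ f ∈ univ.filter (fun f : Fin k → ι => Function.Injective f), F f := by
    refine sum_bij (fun x _ => x.1 ∘ x.2) ?_ ?_ ?_ (fun _ _ => rfl)
    · intro x _
      simpa using x.1.injective.comp x.2.injective
    · rintro ⟨e, σ⟩ _ ⟨e', σ'⟩ _ h
      have hr : Set.range e = Set.range e' := by
        rw [← σ.surjective.range_comp e, ← σ'.surjective.range_comp e']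
        exact congrArg Set.range h
      have he : e = e' := OrderEmbedding.range_inj.1 hr
      subst he
      have : σ = σ' := by
        ext i
        exact congrArg Fin.val (e.injective (congrFun h i))
      rw [this]
    · intro f hf
      have hf : Function.Injective f := by simpa using hf
      -- Sorting writes an injective tuple as an increasing one followed by a permutation.
      have hs : StrictMono (f ∘ Tuple.sort f) :=
        (Tuple.monotone_sort f).strictMono_of_injective (hf.comp (Tuple.sort f).injective)
      refine ⟨⟨OrderEmbedding.ofStrictMono _ hs, (Tuple.sort f)⁻¹⟩, mem_univ _, ?_⟩
      ext i
      simp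
  rw [h1, ← h2, Fintype.sum_prod_type]
  simp only [hperm, sum_const, card_univ, Fintype.card_perm, Fintype.card_fin, smul_sum]

section Compound

variable {ι κ μ : Type*} [LinearOrder ι] [LinearOrder κ] [LinearOrder μ] {R : Type*} [CommRing R]

/-- The `k`-th compound matrix: the matrix of the `k × k` minors. -/
def compound (k : ℕ) (M : Matrix ι κ R) : Matrix (Fin k ↪o ι) (Fin k ↪o κ) R :=
  of fun e f => (M.submatrix e f).det

theorem compound_apply (k : ℕ) (M : Matrix ι κ R) (e : Fin k ↪o ι) (f : Fin k ↪o κ) :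
    compound k M e f = (M.submatrix e f).det := rfl

omit [LinearOrder ι] [LinearOrder κ] [LinearOrder μ] in
/-- Summing over all tuples of column indices, the Cauchy–Binet formula holds up to `k!`. -/
theorem sum_det_submatrix_mul_det_submatrix [Fintype κ] {k : ℕ} (M : Matrix ι κ R)
    (N : Matrix κ μ R) (e : Fin k → ι) (f : Fin k → μ) :
    ∑ h : Fin k → κ, (M.submatrix e h).det * (N.submatrix h f).det
      = k.factorial • ((M * N).submatrix e f).det := by
  classical
  have key : ∀ σ τ : Perm (Fin k),
      ∑ h : Fin k → κ, (∏ i, M (e (σ i)) (h i)) * ∏ i, N (h i) (f (τ i))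
        = ∏ i, (M * N) (e (σ i)) (f (τ i)) := by
    intro σ τ
    simp only [mul_apply, prod_univ_sum, ← prod_mul_distrib, Fintype.piFinset_univ]
  have hN : ∀ h : Fin k → κ, (N.submatrix h f).det
      = ∑ τ : Perm (Fin k), (Perm.sign τ : ℤ) • ∏ i, N (h i) (f (τ i)) := by
    intro h
    rw [← det_transpose, det_apply]
    rfl
  have hM : ∀ h : Fin k → κ, (M.submatrix e h).det
      = ∑ σ : Perm (Fin k), (Perm.sign σ : ℤ) • ∏ i, M (e (σ i)) (h i) := by
    intro h
    rw [det_apply]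
    rfl
  have hMN : ∀ σ : Perm (Fin k), ∑ τ : Perm (Fin k),
      (Perm.sign σ : ℤ) • (Perm.sign τ : ℤ) • ∏ i, (M * N) (e (σ i)) (f (τ i))
        = ((M * N).submatrix e f).det := by
    intro σ
    have h1 : (((M * N).submatrix e f).submatrix σ id).det
        = (Perm.sign σ : ℤ) • ((M * N).submatrix e f).det := by
      rw [det_permute]
      simp
    have h2 : (((M * N).submatrix e f).submatrix σ id).det
        = ∑ τ : Perm (Fin k), (Perm.sign τ : ℤ) • ∏ i, (M * N) (e (σ i)) (f (τ i)) := by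
      rw [← det_transpose, det_apply]
      rfl
    rw [← smul_sum, ← h2, h1, smul_smul, Int.units_coe_mul_self, one_smul]
  calc ∑ h : Fin k → κ, (M.submatrix e h).det * (N.submatrix h f).det
      = ∑ h : Fin k → κ, ∑ σ : Perm (Fin k), ∑ τ : Perm (Fin k),
          (Perm.sign σ : ℤ) • (Perm.sign τ : ℤ) •
            ((∏ i, M (e (σ i)) (h i)) * ∏ i, N (h i) (f (τ i))) := by
        refine sum_congr rfl fun h _ => ?_
        rw [hM, hN, sum_mul_sum]
        simp only [smul_mul_smul_comm, mul_smul]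
    _ = ∑ σ : Perm (Fin k), ∑ τ : Perm (Fin k), (Perm.sign σ : ℤ) • (Perm.sign τ : ℤ) •
          ∏ i, (M * N) (e (σ i)) (f (τ i)) := by
        rw [sum_comm]
        refine sum_congr rfl fun σ _ => ?_
        rw [sum_comm]
        refine sum_congr rfl fun τ _ => ?_
        rw [← smul_sum, ← smul_sum, key]
    _ = k.factorial • ((M * N).submatrix e f).det := by
        simp only [hMN, sum_const, card_univ, Fintype.card_perm, Fintype.card_fin]

/-- The **Cauchy–Binet formula**: compound matrices are multiplicative. -/
theorem compound_mul [Fintype κ] [IsDomain R] [CharZero R] (k : ℕ) (M : Matrix ι κ R)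
    (N : Matrix κ μ R) : compound k (M * N) = compound k M * compound k N := by
  ext e f
  have h := sum_tuples_eq_factorial_smul_sum_orderEmb
    (fun h : Fin k → κ => (M.submatrix e h).det * (N.submatrix h f).det) ?_ ?_
  · rw [sum_det_submatrix_mul_det_submatrix] at h
    rw [mul_apply]
    -- Cancelling `k!` is where characteristic zero enters.
    have := smul_right_injective R (Nat.factorial_ne_zero k) h
    exact this
  · intro h σ
    have h1 : (M.submatrix e (h ∘ σ)).det = (Perm.sign σ : ℤ) * (M.submatrix e h).det :=
      det_permute' σ (M.submatrix e h)
    have h2 : (N.submatrix (h ∘ σ) f).det = (Perm.sign σ : ℤ) * (N.submatrix h f).det :=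
      det_permute σ (N.submatrix h f)
    simp only [h1, h2]
    have h3 : ((Perm.sign σ : ℤ) : R) * ((Perm.sign σ : ℤ) : R) = 1 := by
      rw [← Int.cast_mul, Int.units_coe_mul_self, Int.cast_one]
    rw [mul_mul_mul_comm, h3, one_mul]
  · intro h hh
    obtain ⟨i, j, hij, hne⟩ : ∃ i j, h i = h j ∧ i ≠ j := by
      simpa [Function.Injective] using hh
    have : (N.submatrix h f).det = 0 := det_zero_of_row_eq hne (by ext; simp [hij])
    simp [this]

theorem compound_conjTranspose [StarRing R] (k : ℕ) (M : Matrix ι κ R) :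
    compound k Mᴴ = (compound k M)ᴴ := by
  ext e f
  rw [conjTranspose_apply, compound_apply, compound_apply, ← det_conjTranspose,
    conjTranspose_submatrix]

theorem compound_diagonal [DecidableEq ι] (k : ℕ) (d : ι → R) :
    compound k (diagonal d) = diagonal fun e : Fin k ↪o ι => ∏ i, d (e i) := by
  ext e f
  rw [compound_apply]
  rcases eq_or_ne e f with rfl | hne
  · rw [submatrix_diagonal _ _ e.injective, det_diagonal, diagonal_apply_eq]
    rfl
  · rw [diagonal_apply_ne _ hne]
    -- Distinct increasing tuples have distinct ranges of equal size, so `e` takes a value missed by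
    -- `f`, and the minor has a zero row.
    obtain ⟨i, hi⟩ : ∃ i, e i ∉ Set.range f := by
      by_contra! h
      refine hne (OrderEmbedding.range_inj.1 ?_)
      have hsub : Set.range e ⊆ Set.range f := Set.range_subset_iff.2 h
      have hs : univ.image e ⊆ univ.image f := by
        rw [← coe_subset]; simpa using hsub
      have := eq_of_subset_of_card_le hs (by
        rw [card_image_of_injective _ e.injective, card_image_of_injective _ f.injective])
      simpa using congrArg (fun s : Finset ι => (s : Set ι)) this
    refine det_eq_zero_of_row_eq_zero i fun j => ?_
    rw [submatrix_apply, diagonal_apply_ne _ fun h => hi ⟨j, h.symm⟩]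

theorem compound_one [DecidableEq ι] (k : ℕ) : compound k (1 : Matrix ι ι R) = 1 := by
  rw [← diagonal_one, compound_diagonal]
  simp

end Compound

end Matrix

/-! ### Operator inequalities and normal elements in C⋆-algebras. -/

section CStarAlgebra

open CFC Filter Topology
open scoped NNReal

variable {A : Type*} [CStarAlgebra A] [PartialOrder A] [StarOrderedRing A]

theorem CFC.nnreal_smul_rpow (r : ℝ≥0) {a : A} (ha : 0 ≤ a) {q : ℝ} (hq : 0 ≤ q) :
    (r • a) ^ q = r ^ q • a ^ q := by
  have hc : ∀ s : Set ℝ≥0, ContinuousOn (fun x : ℝ≥0 => x ^ q) s := fun s =>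
    (NNReal.continuous_rpow_const hq).continuousOn
  rw [rpow_def, rpow_def, ← cfc_comp_smul r (fun x : ℝ≥0 => x ^ q) a (hc _) ha,
    ← cfc_smul (r ^ q) (fun x : ℝ≥0 => x ^ q) a (hc _)]
  simp only [smul_eq_mul, NNReal.mul_rpow]

/-- With `c` the right-hand norm, `w ≤ c a^(-2p)`. Löwner–Heinz with exponent `1/p ≤ 1` gives
`w^(1/p) ≤ c^(1/p) a^(-2)`, and conjugating by `a` finishes. -/
theorem norm_mul_rpow_inv_mul_rpow_le_of_isStrictlyPositive {a w : A} (ha : IsStrictlyPositive a)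
    (hw : 0 ≤ w) {p : ℝ} (hp : 1 ≤ p) :
    ‖a * w ^ p⁻¹ * a‖ ^ p ≤ ‖a ^ p * w * a ^ p‖ := by
  have hp0 : 0 < p := one_pos.trans_le hp
  set c : ℝ≥0 := ‖a ^ p * w * a ^ p‖₊ with hc
  have hap : ∀ x : ℝ, IsSelfAdjoint (a ^ x) := fun x => rpow_nonneg.isSelfAdjoint
  have hpos : 0 ≤ a ^ p * w * a ^ p := (hap p).conjugate_nonneg hw
  have h1 : a ^ p * w * a ^ p ≤ algebraMap ℝ≥0 A c :=
    (CStarAlgebra.nnnorm_le_iff_of_nonneg _ _ hpos).1 le_rfl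
  have h2 : w ≤ c • a ^ (-(2 * p)) := by
    have h := (hap (-p)).conjugate_le_conjugate h1
    have e1 : a ^ (-p) * (a ^ p * w * a ^ p) * a ^ (-p) = w := by
      calc _ = (a ^ (-p) * a ^ p) * w * (a ^ p * a ^ (-p)) := by simp only [mul_assoc]
        _ = w := by rw [rpow_neg_mul_rpow p ha, rpow_mul_rpow_neg p ha, one_mul, mul_one]
    have e2 : a ^ (-p) * algebraMap ℝ≥0 A c * a ^ (-p) = c • a ^ (-(2 * p)) := by
      rw [Algebra.algebraMap_eq_smul_one, mul_smul_comm, mul_one, smul_mul_assoc,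
        ← rpow_add ha.isUnit]
      congr 2
      ring
    rwa [e1, e2] at h
  have h3 : w ^ p⁻¹ ≤ c ^ p⁻¹ • a ^ (-2 : ℝ) := by
    have h := rpow_le_rpow (p := p⁻¹) ⟨(inv_pos.2 hp0).le, inv_le_one_of_one_le₀ hp⟩ h2
    rw [nnreal_smul_rpow _ rpow_nonneg (inv_pos.2 hp0).le, rpow_rpow a _ _ (by linarith) ha] at h
    convert h using 3
    field_simp
  have h4 : a * w ^ p⁻¹ * a ≤ algebraMap ℝ≥0 A (c ^ p⁻¹) := by
    have h := ha.nonneg.isSelfAdjoint.conjugate_le_conjugate h3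
    have e : a * a ^ (-2 : ℝ) * a = 1 := by
      have h1 : a * a ^ (-2 : ℝ) * a = a ^ (1 : ℝ) * a ^ (-2 : ℝ) * a ^ (1 : ℝ) := by
        rw [rpow_one a ha.nonneg]
      rw [h1, ← rpow_add ha.isUnit, ← rpow_add ha.isUnit]
      norm_num
      exact rpow_zero a ha.nonneg
    rwa [mul_smul_comm, smul_mul_assoc, e, ← Algebra.algebraMap_eq_smul_one] at h
  have h5 : ‖a * w ^ p⁻¹ * a‖₊ ≤ c ^ p⁻¹ :=
    (CStarAlgebra.nnnorm_le_iff_of_nonneg _ _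
      (ha.nonneg.isSelfAdjoint.conjugate_nonneg rpow_nonneg)).2 h4
  have h6 : ‖a * w ^ p⁻¹ * a‖₊ ^ p ≤ c := by
    calc _ ≤ (c ^ p⁻¹) ^ p := NNReal.rpow_le_rpow h5 hp0.le
      _ = c := NNReal.rpow_inv_rpow hp0.ne' c
  exact_mod_cast h6

/-- The **Araki–Cordes inequality** for the norm of a C⋆-algebra. -/
theorem norm_mul_rpow_inv_mul_rpow_le {a w : A} (ha : 0 ≤ a) (hw : 0 ≤ w) {p : ℝ} (hp : 1 ≤ p) :
    ‖a * w ^ p⁻¹ * a‖ ^ p ≤ ‖a ^ p * w * a ^ p‖ := by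
  have hp0 : 0 < p := one_pos.trans_le hp
  -- Invertibility is gained by replacing `a` with `a + t` and letting `t → 0+`; powers are
  -- continuous on the nonnegative elements.
  let b : ℝ → A := fun t => a + algebraMap ℝ A t
  have hb0 : b 0 = a := by simp [b]
  have hbc : Continuous b := continuous_const.add (continuous_algebraMap ℝ A)
  have hbpos : ∀ t, 0 < t → IsStrictlyPositive (b t) := fun t ht =>
    IsStrictlyPositive.nonneg_add ha (isStrictlyPositive_algebraMap ht)
  have hb : Tendsto b (𝓝[>] 0) (𝓝 a) := by
    have := hbc.tendsto 0
    rw [hb0] at this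
    exact this.mono_left nhdsWithin_le_nhds
  have hbw : Tendsto b (𝓝[>] 0) (𝓝[{x : A | 0 ≤ x}] a) :=
    tendsto_nhdsWithin_iff.2 ⟨hb, eventually_nhdsWithin_of_forall fun t ht => (hbpos t ht).nonneg⟩
  have hbp : Tendsto (fun t => b t ^ p) (𝓝[>] 0) (𝓝 (a ^ p)) := by
    have h := (continuousOn_nnrpow (A := A) p.toNNReal a ha).tendsto.comp hbw
    have e : ∀ x : A, x ^ p.toNNReal = x ^ p := fun x => by
      rw [nnrpow_eq_rpow (Real.toNNReal_pos.2 hp0), Real.coe_toNNReal _ hp0.le]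
    simpa only [Function.comp_def, e] using h
  refine le_of_tendsto_of_tendsto (b := 𝓝[>] (0 : ℝ))
    (f := fun t => ‖b t * w ^ p⁻¹ * b t‖ ^ p) (g := fun t => ‖b t ^ p * w * b t ^ p‖) ?_ ?_ ?_
  · exact ((hb.mul_const _).mul hb).norm.rpow_const (Or.inr hp0.le)
  · exact ((hbp.mul_const _).mul hbp).norm
  · exact eventually_nhdsWithin_of_forall fun t ht =>
      norm_mul_rpow_inv_mul_rpow_le_of_isStrictlyPositive (hbpos t ht) hw hp

/-- The power mean inequality for sums of positive elements of a C⋆-algebra. -/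
theorem sum_le_rpow_inv_sum_rpow {ι : Type*} [Fintype ι] (b : ι → A) (hb : ∀ i, 0 ≤ b i)
    {p : ℝ} (hp : 1 ≤ p) :
    ∑ i, b i ≤ ((Fintype.card ι : ℝ) ^ (p - 1) • ∑ i, b i ^ p) ^ p⁻¹ := by
  have hp0 : 0 < p := one_pos.trans_le hp
  rcases isEmpty_or_nonempty ι with h | h
  · simp
  have hm : (0 : ℝ≥0) < Fintype.card ι := by exact_mod_cast Fintype.card_pos
  set m : ℝ≥0 := (Fintype.card ι : ℝ≥0) with hm_def
  have hroot : ∀ i, (b i ^ p) ^ p⁻¹ = b i := fun i => by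
    rw [rpow_rpow_of_exponent_nonneg _ _ _ hp0.le (inv_pos.2 hp0).le (hb i),
      mul_inv_cancel₀ hp0.ne', rpow_one _ (hb i)]
  -- Operator concavity with equal weights `1/m` at the points `b i ^ p`.
  have hconc := (concaveOn_rpow (A := A) (p := p⁻¹)
    ⟨(inv_pos.2 hp0).le, inv_le_one_of_one_le₀ hp⟩).le_map_sum (t := Finset.univ)
    (w := fun _ : ι => ((m⁻¹ : ℝ≥0) : ℝ)) (p := fun i => b i ^ p) (fun _ _ => NNReal.coe_nonneg _)
    (by simp [hm_def]) (fun _ _ => rpow_nonneg)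
  simp only [hroot, ← Finset.smul_sum, ← NNReal.smul_def] at hconc
  have hS : 0 ≤ ∑ i, b i ^ p := Finset.sum_nonneg fun _ _ => rpow_nonneg
  have hsm : ∀ r : ℝ≥0, ∀ x : A, 0 ≤ x → 0 ≤ r • x := fun r x hx => smul_nonneg r.2 hx
  have h2 : m • m⁻¹ • ∑ i, b i ≤ m • (m⁻¹ • ∑ i, b i ^ p) ^ p⁻¹ := by
    rw [← sub_nonneg, ← smul_sub]
    exact hsm _ _ (sub_nonneg.2 hconc)
  rw [smul_inv_smul₀ hm.ne'] at h2
  have e1 : (Fintype.card ι : ℝ) ^ (p - 1) • ∑ i, b i ^ p = (m ^ (p - 1)) • ∑ i, b i ^ p := by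
    rw [NNReal.smul_def]
    simp [hm_def]
  rw [e1]
  refine h2.trans_eq ?_
  rw [nnreal_smul_rpow _ hS (inv_pos.2 hp0).le, nnreal_smul_rpow _ hS (inv_pos.2 hp0).le, smul_smul]
  congr 1
  -- The constants agree: `m * m^(-1/p) = (m^(p-1))^(1/p)`.
  rw [← NNReal.rpow_mul, NNReal.inv_rpow, ← NNReal.rpow_neg]
  nth_rewrite 1 [← NNReal.rpow_one m]
  rw [← NNReal.rpow_add hm.ne']
  congr 1
  field_simp
  ring

/-- The modulus is `√‖z‖`, which settles continuity at `0`. This is the second factor when a normal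
element is split below. -/
theorem Complex.continuous_div_sqrt_norm : Continuous fun z : ℂ => z / (√‖z‖ : ℂ) := by
  refine continuous_iff_continuousAt.2 fun z => ?_
  rcases eq_or_ne z 0 with rfl | hz
  · rw [ContinuousAt, zero_div]
    have h : Tendsto (fun z : ℂ => √‖z‖) (𝓝 0) (𝓝 0) := by
      have : Continuous fun z : ℂ => √‖z‖ := by fun_prop
      simpa using this.tendsto 0
    refine squeeze_zero_norm (fun z => ?_) h
    rw [norm_div, Complex.norm_real, Real.norm_of_nonneg (Real.sqrt_nonneg _), Real.div_sqrt]
  · refine ContinuousAt.div continuousAt_id (by fun_prop) ?_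
    simpa [Real.sqrt_eq_zero'] using hz

/-- A normal element `x` of a C⋆-algebra factors as `x = g⋆ h` with `g⋆ g = h⋆ h = |x|`. -/
theorem exists_star_mul_eq_of_isStarNormal (x : A) (hx : IsStarNormal x) :
    ∃ g h : A, star g * h = x ∧ star g * g = CFC.abs x ∧ star h * h = CFC.abs x := by
  have hg : ContinuousOn (fun z : ℂ => (√‖z‖ : ℂ)) (spectrum ℂ x) :=
    Continuous.continuousOn (by fun_prop)
  have hh : ContinuousOn (fun z : ℂ => z / (√‖z‖ : ℂ)) (spectrum ℂ x) :=
    Complex.continuous_div_sqrt_norm.continuousOn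
  have hsq : ∀ z : ℂ, (√‖z‖ : ℂ) * (√‖z‖ : ℂ) = ‖z‖ := fun z => by
    rw [← Complex.ofReal_mul, Real.mul_self_sqrt (norm_nonneg z)]
  have habs : CFC.abs x = cfc (fun z : ℂ => (‖z‖ : ℂ)) x := by
    rw [abs_eq_cfcₙ_coe_norm ℂ x, cfcₙ_eq_cfc]
    rfl
  refine ⟨cfc (fun z : ℂ => (√‖z‖ : ℂ)) x, cfc (fun z : ℂ => z / (√‖z‖ : ℂ)) x, ?_, ?_, ?_⟩
  · rw [← cfc_star, ← cfc_mul _ _ x hg.star hh]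
    conv_rhs => rw [← cfc_id' ℂ x]
    refine cfc_congr fun z _ => ?_
    rcases eq_or_ne z 0 with rfl | hz
    · simp
    · have : (√‖z‖ : ℂ) ≠ 0 := by simpa [Real.sqrt_eq_zero'] using hz
      simp [mul_div_cancel₀ _ this]
  · rw [← cfc_star, ← cfc_mul _ _ x hg.star hg, habs]
    exact cfc_congr fun z _ => by simp [hsq]
  · rw [← cfc_star, ← cfc_mul _ _ x hh.star hh, habs]
    refine cfc_congr fun z _ => ?_
    rcases eq_or_ne z 0 with rfl | hz
    · simp
    · have : (‖z‖ : ℂ) ≠ 0 := by simpa using hz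
      simp only [RCLike.star_def, map_div₀, Complex.conj_ofReal]
      rw [div_mul_div_comm, hsq, Complex.conj_mul', div_eq_iff this, sq]

end CStarAlgebra

/-! ### Largest products and functional calculus of diagonalized matrices. -/

theorem Finset.prod_le_prod_filter_lt_of_antitone {N : ℕ} {a : Fin N → ℝ} (ha : Antitone a)
    (ha0 : ∀ i, 0 ≤ a i) (s : Finset (Fin N)) :
    ∏ i ∈ s, a i ≤ ∏ i ∈ univ.filter (fun i : Fin N => (i : ℕ) < s.card), a i := by
  have hk : s.card ≤ N := by simpa using s.card_le_univ
  have h1 : ∏ i ∈ s, a i = ∏ i : Fin s.card, a (s.orderEmbOfFin rfl i) := by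
    conv_lhs => rw [← s.map_orderEmbOfFin_univ rfl, prod_map]
    rfl
  have h2 : ∏ i ∈ univ.filter (fun i : Fin N => (i : ℕ) < s.card), a i
      = ∏ i : Fin s.card, a (Fin.castLE hk i) := by
    have : univ.filter (fun i : Fin N => (i : ℕ) < s.card) = univ.map (Fin.castLEEmb hk) := by
      ext i
      simp only [mem_filter, mem_univ, true_and, mem_map, Fin.castLEEmb_apply]
      exact ⟨fun h => ⟨⟨i, h⟩, rfl⟩, by rintro ⟨j, rfl⟩; exact j.2⟩
    rw [this, prod_map]
    rfl
  rw [h1, h2]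
  refine prod_le_prod (fun i _ => ha0 _) fun i _ => ha ?_
  -- Counting from `0`, the `m`-th smallest element of `s` is at least `m`.
  have hi : ∀ m (hm : m < s.card), m ≤ (s.orderEmbOfFin rfl ⟨m, hm⟩ : ℕ) := by
    intro m
    induction m with
    | zero => exact fun _ => Nat.zero_le _
    | succ m ih =>
      intro hm
      have h : s.orderEmbOfFin rfl ⟨m, by omega⟩ < s.orderEmbOfFin rfl ⟨m + 1, hm⟩ :=
        (s.orderEmbOfFin rfl).strictMono (Fin.mk_lt_mk.2 (Nat.lt_succ_self m))
      exact (ih (by omega)).trans_lt h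
  exact hi i i.2

namespace Matrix

section UnitaryDiagonal

variable {ι : Type*} [Fintype ι] [DecidableEq ι]

theorem cfc_mul_diagonal_mul_star (U : unitaryGroup ι ℂ) (d : ι → ℝ) (f : ℝ → ℝ) :
    cfc f ((U : Matrix ι ι ℂ) * diagonal (fun i => (d i : ℂ)) * star (U : Matrix ι ι ℂ))
      = (U : Matrix ι ι ℂ) * diagonal (fun i => (f (d i) : ℂ)) * star (U : Matrix ι ι ℂ) := by
  let φ : (ι → ℝ) →ₐ[ℝ] Matrix ι ι ℂ :=
    (((Unitary.conjStarAlgAut ℂ (Matrix ι ι ℂ) U).toAlgEquiv.toAlgHom.comp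
      (diagonalAlgHom ℂ)).restrictScalars ℝ).comp (Complex.ofRealAm.compLeft ι)
  have hφ : ∀ d : ι → ℝ, φ d
      = (U : Matrix ι ι ℂ) * diagonal (fun i => (d i : ℂ)) * star (U : Matrix ι ι ℂ) :=
    fun d => rfl
  rw [← hφ, ← hφ]
  have hsa : IsSelfAdjoint (φ d) := by
    rw [hφ]
    refine IsSelfAdjoint.conjugate ?_ _
    change (diagonal fun i => (d i : ℂ))ᴴ = _
    rw [diagonal_conjTranspose]
    congr 1
    ext i
    simp
  -- On the finite spectrum `f` agrees with an interpolating polynomial, which commutes with the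
  -- algebra homomorphism `φ`.
  let P : Polynomial ℝ := Lagrange.interpolate (Finset.univ.image d) id f
  have hP : ∀ i, P.eval (d i) = f (d i) := fun i =>
    Lagrange.eval_interpolate_at_node f (Set.injOn_id _)
      (Finset.mem_image_of_mem d (Finset.mem_univ i))
  have hspec : ∀ x ∈ spectrum ℝ (φ d), f x = P.eval x := by
    intro x hx
    have hx : x ∈ spectrum ℝ d := AlgHom.spectrum_apply_subset φ d hx
    rw [Pi.spectrum_eq] at hx
    obtain ⟨i, hi⟩ := Set.mem_iUnion.1 hx
    rw [show spectrum ℝ (d i) = {d i} from spectrum.scalar_eq (d i)] at hi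
    rw [Set.mem_singleton_iff.1 hi, hP]
  rw [cfc_congr hspec, cfc_polynomial P (φ d) hsa, Polynomial.aeval_algHom_apply]
  refine congrArg φ (funext fun i => ?_)
  rw [← hP]
  exact (Polynomial.aeval_algHom_apply (Pi.evalAlgHom ℝ (fun _ : ι => ℝ) i) d P).symm

theorem isHermitian_spectral {X : Matrix ι ι ℂ} (hX : X.IsHermitian) :
    X = (hX.eigenvectorUnitary : Matrix ι ι ℂ) * diagonal (fun i => (hX.eigenvalues i : ℂ))
      * star (hX.eigenvectorUnitary : Matrix ι ι ℂ) :=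
  hX.spectral_theorem

theorem rpow_mul_diagonal_mul_star (U : unitaryGroup ι ℂ) {d : ι → ℝ} (hd : ∀ i, 0 ≤ d i) (q : ℝ) :
    ((U : Matrix ι ι ℂ) * diagonal (fun i => (d i : ℂ)) * star (U : Matrix ι ι ℂ)) ^ q
      = (U : Matrix ι ι ℂ) * diagonal (fun i => ((d i ^ q : ℝ) : ℂ)) * star (U : Matrix ι ι ℂ) := by
  have h0 : 0 ≤ (U : Matrix ι ι ℂ) * diagonal (fun i => (d i : ℂ)) * star (U : Matrix ι ι ℂ) := by
    refine star_right_conjugate_nonneg (PosSemidef.nonneg ?_) _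
    exact PosSemidef.diagonal fun i => by simpa using hd i
  rw [CFC.rpow_eq_cfc_real h0, cfc_mul_diagonal_mul_star]

end UnitaryDiagonal

/-! ### Operator norms of compounds. -/

section Compound

variable {n : ℕ} {X : Matrix (Fin n) (Fin n) ℂ}

theorem compound_mem_unitaryGroup (k : ℕ) (U : unitaryGroup (Fin n) ℂ) :
    compound k (U : Matrix (Fin n) (Fin n) ℂ) ∈ unitaryGroup (Fin k ↪o Fin n) ℂ := by
  rw [mem_unitaryGroup_iff, star_eq_conjTranspose, ← compound_conjTranspose, ← compound_mul,
    ← star_eq_conjTranspose, mem_unitaryGroup_iff.1 U.2, compound_one]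

theorem compound_mul_diagonal_mul_star (k : ℕ) (U : unitaryGroup (Fin n) ℂ) (d : Fin n → ℝ) :
    compound k ((U : Matrix (Fin n) (Fin n) ℂ) * diagonal (fun i => (d i : ℂ))
        * star (U : Matrix (Fin n) (Fin n) ℂ))
      = compound k (U : Matrix (Fin n) (Fin n) ℂ)
        * diagonal (fun e : Fin k ↪o Fin n => ((∏ i, d (e i) : ℝ) : ℂ))
        * star (compound k (U : Matrix (Fin n) (Fin n) ℂ)) := by
  rw [compound_mul, compound_mul, compound_diagonal, star_eq_conjTranspose, compound_conjTranspose,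
    star_eq_conjTranspose]
  simp only [Complex.ofReal_prod]

theorem compound_rpow (k : ℕ) (hX : X.PosSemidef) (q : ℝ) :
    compound k (X ^ q) = compound k X ^ q := by
  have hs := isHermitian_spectral hX.isHermitian
  have hd := hX.eigenvalues_nonneg
  generalize hX.isHermitian.eigenvalues = d at hs hd
  generalize hX.isHermitian.eigenvectorUnitary = U at hs
  rw [hs, rpow_mul_diagonal_mul_star U hd, compound_mul_diagonal_mul_star,
    compound_mul_diagonal_mul_star]
  have h := rpow_mul_diagonal_mul_star ⟨_, compound_mem_unitaryGroup k U⟩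
    (d := fun e : Fin k ↪o Fin n => ∏ i, d (e i)) (fun e => Finset.prod_nonneg fun i _ => hd _) q
  refine Eq.trans ?_ h.symm
  simp only [Real.finsetProd_rpow _ _ fun i _ => hd _]

theorem compound_posSemidef (k : ℕ) (hX : X.PosSemidef) : (compound k X).PosSemidef := by
  obtain ⟨B, rfl⟩ := CStarAlgebra.nonneg_iff_eq_star_mul_self.mp hX.nonneg
  rw [star_eq_conjTranspose, compound_mul, compound_conjTranspose]
  exact posSemidef_conjTranspose_mul_self _

open scoped Matrix.Norms.L2Operator

/-- Diagonalizing `X` diagonalizes its compound, with eigenvalues the products over `k`-subsets; the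
norm is the largest of these. -/
theorem norm_compound_eq_topEigenvalueProd {k : ℕ} (hk : k ≤ n) (hX : X.PosSemidef) :
    ‖compound k X‖ = topEigenvalueProd hX.isHermitian k := by
  have hs := isHermitian_spectral hX.isHermitian
  have hd := hX.eigenvalues_nonneg
  set τ : Fin (Fintype.card (Fin n)) ≃ Fin n := Fintype.equivOfCardEq (Fintype.card_fin _) with hτ
  set a := hX.isHermitian.eigenvalues₀ with ha_def
  have hda : ∀ j, hX.isHermitian.eigenvalues (τ j) = a j := fun j => by
    simp [IsHermitian.eigenvalues, hτ, a]
  have ha0 : ∀ j, 0 ≤ a j := fun j => hda j ▸ hd _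
  have htop : topEigenvalueProd hX.isHermitian k
      = ∏ j ∈ Finset.univ.filter (fun j : Fin (Fintype.card (Fin n)) => (j : ℕ) < k), a j := rfl
  have hnorm : ‖compound k X‖
      = ‖fun e : Fin k ↪o Fin n => ((∏ i, hX.isHermitian.eigenvalues (e i) : ℝ) : ℂ)‖ := by
    rw [← l2_opNorm_diagonal]
    conv_lhs => rw [hs, compound_mul_diagonal_mul_star]
    have hV := compound_mem_unitaryGroup k hX.isHermitian.eigenvectorUnitary
    rw [CStarRing.norm_mul_mem_unitary _ (Unitary.star_mem hV), CStarRing.norm_mem_unitary_mul _ hV]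
  have hprod : ∀ e : Fin k ↪o Fin n, ∏ i, hX.isHermitian.eigenvalues (e i)
      = ∏ j ∈ (Finset.univ.map e.toEmbedding).map τ.symm.toEmbedding, a j := fun e => by
    simp [Finset.prod_map, ← hda]
  rw [hnorm, htop]
  apply le_antisymm
  · refine (pi_norm_le_iff_of_nonneg (Finset.prod_nonneg fun j _ => ha0 j)).2 fun e => ?_
    rw [Complex.norm_real, Real.norm_of_nonneg (Finset.prod_nonneg fun i _ => hd _), hprod]
    convert Finset.prod_le_prod_filter_lt_of_antitone hX.isHermitian.eigenvalues₀_antitone ha0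
      ((Finset.univ.map e.toEmbedding).map τ.symm.toEmbedding)
    simp
  -- The maximum is attained at the positions of the `k` largest eigenvalues.
  · let s : Finset (Fin n) :=
      (Finset.univ.filter fun j : Fin (Fintype.card (Fin n)) => (j : ℕ) < k).map τ.toEmbedding
    have hs : s.card = k := by
      rw [Finset.card_map, Fin.card_filter_val_lt]
      simpa using hk
    have h := norm_le_pi_norm (fun e : Fin k ↪o Fin n =>
      ((∏ i, hX.isHermitian.eigenvalues (e i) : ℝ) : ℂ)) (s.orderEmbOfFin hs)
    refine le_trans (le_of_eq ?_) h
    rw [Complex.norm_real, Real.norm_of_nonneg (Finset.prod_nonneg fun i _ => hd _), hprod,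
      Finset.map_orderEmbOfFin_univ, Finset.map_map]
    simp

theorem norm_compound_abs (k : ℕ) (N : Matrix (Fin n) (Fin n) ℂ) :
    ‖compound k (CFC.abs N)‖ = ‖compound k N‖ := by
  have h0 : (CFC.abs N)ᴴ = CFC.abs N := (nonneg_iff_posSemidef.1 (CFC.abs_nonneg N)).isHermitian
  have h : (CFC.abs N)ᴴ * CFC.abs N = Nᴴ * N := by
    rw [h0]
    exact CFC.abs_mul_abs N
  have h1 := congrArg (fun M => ‖compound k M‖) h
  simp only [compound_mul, compound_conjTranspose, l2_opNorm_conjTranspose_mul_self] at h1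
  exact (mul_self_inj (norm_nonneg _) (norm_nonneg _)).1 h1

/-- Writing the block as `Z*Z` and splitting the columns of `Z` into `P`, `Q` gives `M = P*P = Q*Q`
and `N = P*Q`; the C⋆-identity and submultiplicativity for compounds conclude. -/
theorem norm_compound_le_of_posSemidef_fromBlocks (k : ℕ) {M N : Matrix (Fin n) (Fin n) ℂ}
    (h : (fromBlocks M N Nᴴ M).PosSemidef) : ‖compound k N‖ ≤ ‖compound k M‖ := by
  obtain ⟨Z, hZ⟩ := CStarAlgebra.nonneg_iff_eq_star_mul_self.mp h.nonneg
  -- Rows are reindexed because compounds need linearly ordered indices.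
  let P : Matrix (Fin (n + n)) (Fin n) ℂ := Z.submatrix finSumFinEquiv.symm Sum.inl
  let Q : Matrix (Fin (n + n)) (Fin n) ℂ := Z.submatrix finSumFinEquiv.symm Sum.inr
  have key : ∀ f g : Fin n → Fin n ⊕ Fin n,
      (Z.submatrix finSumFinEquiv.symm f)ᴴ * Z.submatrix finSumFinEquiv.symm g
        = (fromBlocks M N Nᴴ M).submatrix f g := fun f g => by
    rw [hZ, conjTranspose_submatrix, submatrix_mul_equiv, star_eq_conjTranspose]
  have hPP : Pᴴ * P = M := key _ _
  have hQQ : Qᴴ * Q = M := key _ _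
  have hPQ : Pᴴ * Q = N := key _ _
  have h1 : ‖compound k M‖ = ‖compound k P‖ * ‖compound k P‖ := by
    rw [← hPP, compound_mul, compound_conjTranspose, l2_opNorm_conjTranspose_mul_self]
  have h2 : ‖compound k M‖ = ‖compound k Q‖ * ‖compound k Q‖ := by
    rw [← hQQ, compound_mul, compound_conjTranspose, l2_opNorm_conjTranspose_mul_self]
  have h3 : ‖compound k P‖ = ‖compound k Q‖ :=
    (mul_self_inj (norm_nonneg _) (norm_nonneg _)).1 (h1.symm.trans h2)
  calc ‖compound k N‖ = ‖(compound k P)ᴴ * compound k Q‖ := by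
        rw [← hPQ, compound_mul, compound_conjTranspose]
    _ ≤ ‖(compound k P)ᴴ‖ * ‖compound k Q‖ := l2_opNorm_mul _ _
    _ = ‖compound k M‖ := by rw [l2_opNorm_conjTranspose, ← h3, h1]

/-- Araki's log-majorization inequality, in terms of the norms of compound matrices. -/
theorem norm_compound_mul_rpow_inv_mul_rpow_le (k : ℕ) {A W : Matrix (Fin n) (Fin n) ℂ}
    (hA : A.PosSemidef) (hW : W.PosSemidef) {p : ℝ} (hp : 1 ≤ p) :
    ‖compound k (A * W ^ p⁻¹ * A)‖ ^ p ≤ ‖compound k (A ^ p * W * A ^ p)‖ := by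
  simp only [compound_mul, compound_rpow k hA, compound_rpow k hW]
  exact norm_mul_rpow_inv_mul_rpow_le (compound_posSemidef k hA).nonneg
    (compound_posSemidef k hW).nonneg hp

/-- It is the Gram matrix of the two factors of `X`; normality is what puts `|X|` in both diagonal
corners. -/
theorem posSemidef_fromBlocks_abs (hX : IsStarNormal X) :
    (fromBlocks (CFC.abs X) X Xᴴ (CFC.abs X)).PosSemidef := by
  obtain ⟨G, H, h1, h2, h3⟩ := exists_star_mul_eq_of_isStarNormal X hX
  have h : fromBlocks (CFC.abs X) X Xᴴ (CFC.abs X) = (fromCols G H)ᴴ * fromCols G H := by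
    rw [conjTranspose_fromCols_eq_fromRows_conjTranspose, fromRows_mul_fromCols]
    rw [star_eq_conjTranspose] at h1 h2 h3
    rw [h2, h3, ← h1, conjTranspose_mul, conjTranspose_conjTranspose]
  rw [h]
  exact posSemidef_conjTranspose_mul_self _

theorem sum_abs_le_rpow_inv {m : ℕ} (X : Fin m → Matrix (Fin n) (Fin n) ℂ) {p : ℝ} (hp : 1 ≤ p) :
    ∑ j, CFC.abs (X j) ≤ ((m : ℝ) ^ (p - 1) • ∑ j, CFC.abs (X j) ^ p) ^ p⁻¹ := by
  have h := sum_le_rpow_inv_sum_rpow (fun j => CFC.abs (X j)) (fun j => CFC.abs_nonneg _) hp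
  rwa [Fintype.card_fin] at h

end Compound
end Matrix

/-! ### Block matrices of the sum and the final chain of norms. -/

namespace Matrix

variable {n m : ℕ}

theorem posSemidef_fromBlocks_diag {B : Matrix (Fin n) (Fin n) ℂ} (hB : B.PosSemidef) :
    (fromBlocks B 0 0 B).PosSemidef := by
  obtain ⟨C, rfl⟩ := CStarAlgebra.nonneg_iff_eq_star_mul_self.mp hB.nonneg
  have h := posSemidef_conjTranspose_mul_self (fromBlocks C 0 0 C)
  rw [fromBlocks_conjTranspose, fromBlocks_multiply] at h
  simpa [star_eq_conjTranspose] using h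

/-- Sum the blocks of the `X j`, then add `diag(D, D)` with `D = T - ∑ |X j| ≥ 0`. -/
theorem posSemidef_fromBlocks_sum_of_sum_abs_le (X : Fin m → Matrix (Fin n) (Fin n) ℂ)
    (hX : ∀ j, IsStarNormal (X j)) {T : Matrix (Fin n) (Fin n) ℂ} (hT : ∑ j, CFC.abs (X j) ≤ T) :
    (fromBlocks T (∑ j, X j) (∑ j, X j)ᴴ T).PosSemidef := by
  have h1 : (∑ j, fromBlocks (CFC.abs (X j)) (X j) (X j)ᴴ (CFC.abs (X j))).PosSemidef :=
    posSemidef_sum _ fun j _ => posSemidef_fromBlocks_abs (hX j)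
  have h2 := h1.add (posSemidef_fromBlocks_diag (le_iff.1 hT))
  convert h2 using 1
  ext (i | i) (j | j) <;> simp [sum_apply]

theorem PosSemidef.fromBlocks_mul_mul {A T S : Matrix (Fin n) (Fin n) ℂ} (hA : A.IsHermitian)
    (h : (fromBlocks T S Sᴴ T).PosSemidef) :
    (fromBlocks (A * T * A) (A * S * A) (A * S * A)ᴴ (A * T * A)).PosSemidef := by
  have h1 := h.conjTranspose_mul_mul_same (fromBlocks A 0 0 A)
  rw [fromBlocks_conjTranspose, fromBlocks_multiply, fromBlocks_multiply] at h1
  simpa [hA.eq, conjTranspose_mul, mul_assoc] using h1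

open scoped Matrix.Norms.L2Operator in
theorem norm_compound_abs_rpow_le (k : ℕ) {A : Matrix (Fin n) (Fin n) ℂ} (hA : A.PosSemidef)
    (X : Fin m → Matrix (Fin n) (Fin n) ℂ) (hX : ∀ j, IsStarNormal (X j))
    {p : ℝ} (hp : 1 ≤ p) :
    ‖compound k (CFC.abs (A * (∑ j, X j) * A) ^ p)‖
      ≤ ‖compound k ((m : ℝ) ^ (p - 1) • (A ^ p * (∑ j, CFC.abs (X j) ^ p) * A ^ p))‖ := by
  have hp0 : 0 < p := one_pos.trans_le hp
  have habs : (CFC.abs (A * (∑ j, X j) * A)).PosSemidef :=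
    nonneg_iff_posSemidef.1 (CFC.abs_nonneg _)
  have hW : ((m : ℝ) ^ (p - 1) • ∑ j, CFC.abs (X j) ^ p).PosSemidef :=
    (posSemidef_sum _ fun j _ => nonneg_iff_posSemidef.1 CFC.rpow_nonneg).smul (by positivity)
  rw [compound_rpow k habs, CFC.norm_rpow _ hp0 (compound_posSemidef k habs).nonneg,
    norm_compound_abs]
  have hblock := (posSemidef_fromBlocks_sum_of_sum_abs_le X hX
    (sum_abs_le_rpow_inv X hp)).fromBlocks_mul_mul hA.isHermitian
  calc _ ≤ _ := Real.rpow_le_rpow (norm_nonneg _)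
        (norm_compound_le_of_posSemidef_fromBlocks k hblock) hp0.le
    _ ≤ _ := norm_compound_mul_rpow_inv_mul_rpow_le k hA hW hp
    _ = _ := by rw [mul_smul_comm, smul_mul_assoc]

end Matrix

theorem mainTheorem4 {n m : ℕ} (A : Matrix (Fin n) (Fin n) ℂ) (hA : A.PosSemidef)
    (X : Fin m → Matrix (Fin n) (Fin n) ℂ) (hX : ∀ k, IsStarNormal (X k))
    (p : ℝ) (hp : 1 ≤ p) :
    WeakLogMajorized (CFC.abs (A * (∑ k, X k) * A) ^ p)
      ((m : ℝ) ^ (p - 1) • (A ^ p * (∑ k, CFC.abs (X k) ^ p) * A ^ p)) := by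
  have hL : (CFC.abs (A * (∑ k, X k) * A) ^ p).PosSemidef :=
    Matrix.nonneg_iff_posSemidef.1 CFC.rpow_nonneg
  have hR : ((m : ℝ) ^ (p - 1) • (A ^ p * (∑ k, CFC.abs (X k) ^ p) * A ^ p)).PosSemidef := by
    refine Matrix.PosSemidef.smul ?_ (by positivity)
    have hAp : IsSelfAdjoint (A ^ p) := (CFC.rpow_nonneg (a := A)).isSelfAdjoint
    exact Matrix.nonneg_iff_posSemidef.1
      (hAp.conjugate_nonneg (Finset.sum_nonneg fun _ _ => CFC.rpow_nonneg))
  refine ⟨hL, hR, fun k _ hk => ?_⟩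
  rw [← Matrix.norm_compound_eq_topEigenvalueProd hk hL,
    ← Matrix.norm_compound_eq_topEigenvalueProd hk hR]
  exact Matrix.norm_compound_abs_rpow_le k hA X hX hp
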